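/- Let $K_{a,b}$ denote the complete bipartite graph with parts $A$ and $B$, where $|A|=a$ and $|B|=b$. It is called $(k_A,k_B)$-choosable if, whenever each vertex of $A$ is assigned a list of exactly $k_A$ positive integers and each vertex of $B$ is assigned a list of exactly $k_B$ positive integers, there is a proper colouring in which every vertex receives a colour from its own list. There is an absolute constant $C$ such that the following holds. Let $b\ge 5$ and $\delta\ge Cb$ be integers, and write $\delta=q(b-1)+r$ with integers $q$ and $0\le r\le b-2$. Then, for every integer $a\ge 0$, $K_{a,b}$ is $(b-1,\delta)$-choosable if and only if $$a<\delta^{b-1}-\bigl((b-2)q+r\bigr)^{b-1-r}\bigl((b-2)q+r-1\bigr)^{r}.$$ Moreover, for $1\ll b\ll\delta$ this bound is approximately $(1-1/e)\,\delta^{b-1}$: for every $\varepsilon>0$ there are $b_0$ and $C'$ such that, whenever $b\ge \max(b_0,5)$, $\delta\ge C'b$ and $\delta=q(b-1)+r$ with integers $q$ and $0\le r\le b-2$, $$\Bigl|\,\delta^{b-1}-\bigl((b-2)q+r\bigr)^{b-1-r}\bigl((b-2)q+r-1\bigr)^{r}-\Bigl(1-\frac1e\Bigr)\delta^{b-1}\Bigr|\le\varepsilon\,\delta^{b-1}.$$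 -/

import Mathlib

/-- Let `G` be a graph whose vertex set is split into the two parts `A` and `B`.
`G` is `(kA, kB)`-choosable if, whenever every vertex of `A` gets a list of exactly `kA` positive
integers and every vertex of `B` a list of exactly `kB` positive integers, there is a proper
colouring of `G` that gives each vertex a colour from its own list. -/
def IsBipartiteChoosable {A B : Type*} (G : SimpleGraph (A ⊕ B)) (kA kB : ℕ) : Prop :=
  ∀ (LA : A → Finset ℕ+) (LB : B → Finset ℕ+),
    (∀ u, (LA u).card = kA) → (∀ v, (LB v).card = kB) →
      ∃ c : G.Coloring ℕ+, (∀ u, c (Sum.inl u) ∈ LA u) ∧ (∀ v, c (Sum.inr v) ∈ LB v)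

/-!
Write `n = b - 1`. The lists of the `n + 1` vertices in `B` are sets `S i` of size `δ`, and the lists
in `A` form a family `F` of `n`-sets. There is no colouring exactly when `F` *blocks* `S`: whenever a
point is chosen from each `S i`, the chosen points include a member of `F`
(`isBipartiteChoosable_iff_not_blocks`). So the question is how small a blocking family can be.

If a choice could use fewer than `n` points, no family of `n`-sets would block `S`. Hence no point
lies in three lists and no two disjoint pairs of lists intersect, so that the intersecting pairs form
a star or a triangle (`Blocks.star_or_triangle`). A choice using exactly `n` points forces its set
into `F` (`Blocks.mem_of_card`). The choices from the private parts `Y i`, the points of `S i` in no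
other list, must be blocked by further members of `F`, and each of these leaves out one index `j` and
serves at most `|Y j|` choices (`Blocks.prod_le_mul_card`).

For a star with centre `k` the two counts add up to `δ ^ n - t * ∏ |Y i|`, the product over the `n - 1`
indices other than `k` and the one with the largest private part, with `t` the number of points
missing from those `Y i` (and to `δ ^ n` if the largest private part is that of `k`). The `n` factors
have sum `(n - 1) * δ`, and the integral arithmetic-geometric mean inequality `prod_le_balanced`
gives the bound (`Blocks.star_bound`). It is attained when the centre consists of `q` or `q + 1`
points from each of the other lists (`exists_blocks_balanced`).

For a triangle the counts add up to at least `(11 / 16) * δ ^ n` (`Blocks.triangle_bound`). The bound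
for the star is smaller, as `(1 - 1 / n) ^ n` is at least `81 / 256 > 5 / 16` for `n ≥ 4` and `δ` is
large compared with `n`. This is where `b ≥ 5` is needed.

The asymptotic statement follows from `1 - x ≤ exp (-x)` in one direction (`balanced_prod_le`) and
from the convergence of `(1 - t / n) ^ n`, monotone by Bernoulli's inequality, in the other
(`balanced_prod_ge`, `one_sub_div_pow_mono`).
-/

/-! ### Numerical estimates -/

/-- The exponential through `(v - 1, v - 1)` and `(v, v)` lies above the identity at all natural
numbers: this is Bernoulli's inequality, on either side of `v`. -/
theorem nat_le_balanced_zpow {v : ℕ} (hv : 2 ≤ v) (y : ℕ) :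
    (y : ℝ) ≤ v * (((v : ℝ) - 1) / v) ^ ((v : ℤ) - y) := by
  have hv' : (2 : ℝ) ≤ v := by exact_mod_cast hv
  have hv0 : (0 : ℝ) < v := by linarith
  have hv1 : (0 : ℝ) < (v : ℝ) - 1 := by linarith
  rcases le_total y v with h | h
  · obtain ⟨d, rfl⟩ := Nat.exists_eq_add_of_le h
    have hd : (((y + d : ℕ) : ℤ) - y) = (d : ℤ) := by push_cast; ring
    rw [hd, zpow_natCast]
    set w : ℝ := ((y + d : ℕ) : ℝ) with hw
    have hyw : (y : ℝ) = w - d := by rw [hw]; push_cast; ring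
    have hB := one_add_mul_le_pow (a := -(1 / w)) (by
      have : 1 / w ≤ 1 := by rw [div_le_one hv0]; linarith
      linarith) d
    have e : (w - 1) / w = 1 + -(1 / w) := by field_simp; ring
    rw [e]
    calc (y : ℝ) = w * (1 + d * -(1 / w)) := by rw [hyw]; field_simp; ring
      _ ≤ _ := by gcongr
  · obtain ⟨d, rfl⟩ := Nat.exists_eq_add_of_le h
    have hd : ((v : ℤ) - (v + d : ℕ)) = -(d : ℤ) := by push_cast; ring
    rw [hd, zpow_neg, zpow_natCast, ← inv_pow, inv_div]
    have hB := one_add_mul_le_pow (a := 1 / ((v : ℝ) - 1)) (by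
      have : 0 < 1 / ((v : ℝ) - 1) := by positivity
      linarith) d
    have e : (v : ℝ) / (v - 1) = 1 + 1 / ((v : ℝ) - 1) := by field_simp; ring
    rw [e]
    calc ((v + d : ℕ) : ℝ) = v * (1 + d * (1 / v)) := by push_cast; field_simp
      _ ≤ v * (1 + d * (1 / ((v : ℝ) - 1))) := by
        gcongr
        linarith
      _ ≤ _ := by gcongr

/-- Natural numbers of given number and sum have the largest product when any two differ by at most
one. -/
theorem prod_le_balanced {ι : Type*} (s : Finset ι) (y : ι → ℕ) {v r : ℕ} (hv : 2 ≤ v)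
    (hr : r ≤ s.card) (hsum : ∑ i ∈ s, y i + r = s.card * v) :
    ∏ i ∈ s, y i ≤ v ^ (s.card - r) * (v - 1) ^ r := by
  have hv' : (2 : ℝ) ≤ v := by exact_mod_cast hv
  have hv0 : (v : ℝ) ≠ 0 := by positivity
  have hv1 : ((v : ℝ) - 1) ≠ 0 := by linarith
  have key : (∏ i ∈ s, (y i : ℝ)) ≤ ∏ i ∈ s, (v * (((v : ℝ) - 1) / v) ^ ((v : ℤ) - y i)) :=
    Finset.prod_le_prod (fun i _ => by positivity) fun i _ => nat_le_balanced_zpow hv _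
  have hzp : ∀ t : Finset ι, ∏ i ∈ t, (((v : ℝ) - 1) / v) ^ ((v : ℤ) - y i)
      = (((v : ℝ) - 1) / v) ^ (∑ i ∈ t, ((v : ℤ) - y i)) := by
    classical
    intro t
    induction t using Finset.induction_on with
    | empty => simp
    | insert a t ha ih =>
      rw [Finset.prod_insert ha, Finset.sum_insert ha, ih, zpow_add₀ (by positivity)]
  have hs : ∑ i ∈ s, ((v : ℤ) - y i) = (r : ℤ) := by
    rw [Finset.sum_sub_distrib, Finset.sum_const, nsmul_eq_mul]
    have : ((∑ i ∈ s, y i + r : ℕ) : ℤ) = ((s.card * v : ℕ) : ℤ) := by rw [hsum]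
    push_cast at this
    linarith
  rw [Finset.prod_mul_distrib, hzp, hs, zpow_natCast, Finset.prod_const, div_pow] at key
  have e : (v : ℝ) ^ s.card = v ^ (s.card - r) * v ^ r := by
    rw [← pow_add, Nat.sub_add_cancel hr]
  rw [e] at key
  have h2 : (v : ℝ) ^ (s.card - r) * v ^ r * (((v : ℝ) - 1) ^ r / v ^ r)
      = ((v ^ (s.card - r) * (v - 1) ^ r : ℕ) : ℝ) := by
    have : 1 ≤ v := by omega
    push_cast [this]
    field_simp
  rw [h2] at key
  exact_mod_cast key

/-- With `t = (x + y + z) / 3` the right-hand side is at least `16` times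
`d³ - 3 d² t + 9 d t² - 8 t³`, which is smallest at `t = d / 4`. -/
theorem eleven_cube_le_triangle {d x y z : ℝ} (hx : 0 ≤ x) (hy : 0 ≤ y) (hz : 0 ≤ z)
    (hxy : x + y ≤ d) (hxz : x + z ≤ d) (hyz : y + z ≤ d) :
    11 * d ^ 3 ≤ 16 * (d ^ 2 * (x + y + z) - d * (x * y + x * z + y * z)
      + (d - x - y) * (d - x - z) * (d - y - z)) := by
  obtain ⟨t, ht⟩ : ∃ t, t = (x + y + z) / 3 := ⟨_, rfl⟩
  -- arithmetic-geometric means for the three pairwise sums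
  have amgm : (x + y) * (x + z) * (y + z) ≤ 8 * t ^ 3 := by
    rw [ht]
    nlinarith [mul_nonneg hx (sq_nonneg (y - z)), mul_nonneg hy (sq_nonneg (x - z)),
      mul_nonneg hz (sq_nonneg (x - y)), mul_nonneg hx (sq_nonneg (x - z)),
      mul_nonneg hx (sq_nonneg (x - y)), mul_nonneg hy (sq_nonneg (y - z)),
      mul_nonneg hy (sq_nonneg (y - x)), mul_nonneg hz (sq_nonneg (z - x)),
      mul_nonneg hz (sq_nonneg (z - y))]
  have h1 : 0 ≤ (d / 4 - t) ^ 2 * (5 * d - 8 * t) := by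
    apply mul_nonneg (sq_nonneg _)
    rw [ht]; linarith
  have e : d ^ 2 * (x + y + z) - d * (x * y + x * z + y * z)
      + (d - x - y) * (d - x - z) * (d - y - z)
      = d ^ 3 - d ^ 2 * (3 * t) + d * (3 * t) ^ 2 - (x + y) * (x + z) * (y + z) := by
    rw [ht]; ring
  rw [e]
  nlinarith

/-- `(1 - t / n) ^ n` is monotone in `n ≥ t`. -/
theorem one_sub_div_pow_mono {t : ℝ} {m n : ℕ} (hm : 0 < m) (hmn : m ≤ n) (ht : t ≤ m) :
    (1 - t / m) ^ m ≤ (1 - t / n) ^ n := by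
  have hm' : (0 : ℝ) < m := by exact_mod_cast hm
  have hmn' : (m : ℝ) ≤ n := by exact_mod_cast hmn
  have hn' : (0 : ℝ) < n := by linarith
  have h1 : t / n ≤ 1 := by rw [div_le_one hn']; linarith
  have h1m : t / m ≤ 1 := by rw [div_le_one hm']; linarith
  have hB := one_add_mul_self_le_rpow_one_add (s := -(t / n)) (by linarith)
    (p := (n : ℝ) / m) (by rw [one_le_div hm']; exact hmn')
  have e : 1 + (n : ℝ) / m * -(t / n) = 1 - t / m := by field_simp; ring
  rw [e, ← sub_eq_add_neg] at hB
  calc (1 - t / m) ^ m ≤ ((1 - t / n) ^ ((n : ℝ) / m)) ^ m := by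
        gcongr
    _ = (1 - t / n) ^ n := by
        rw [← Real.rpow_natCast, ← Real.rpow_mul (by linarith), div_mul_cancel₀ _ hm'.ne',
          Real.rpow_natCast]

theorem balanced_prod_ge {n δ q r C : ℕ} (hn : 0 < n) (hC : 0 < C) (hδ : δ = q * n + r)
    (hCδ : C * n ≤ δ) (hq : 1 + (1 : ℝ) / C ≤ n) (hr : r ≤ n) :
    (1 - (1 + 1 / (C : ℝ)) / n) ^ n * (δ : ℝ) ^ n ≤
      ((δ : ℝ) - q) ^ (n - r) * ((δ : ℝ) - q - 1) ^ r := by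
  have hn' : (0 : ℝ) < n := by exact_mod_cast hn
  have hC' : (0 : ℝ) < C := by exact_mod_cast hC
  have hCδ' : (C : ℝ) * n ≤ δ := by exact_mod_cast hCδ
  have hδ0 : (0 : ℝ) < δ := lt_of_lt_of_le (by positivity) hCδ'
  have hqd : (q : ℝ) * n ≤ δ := by rw [hδ]; push_cast; linarith [Nat.cast_nonneg (α := ℝ) r]
  have hbase : (1 - (1 + 1 / (C : ℝ)) / n) * δ ≤ (δ : ℝ) - q - 1 := by
    have h1 : (q : ℝ) ≤ δ / n := by rw [le_div_iff₀ hn']; exact hqd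
    have h2 : 1 ≤ (δ : ℝ) / (C * n) := by rw [le_div_iff₀ (by positivity)]; linarith
    have e : (1 - (1 + 1 / (C : ℝ)) / n) * δ = δ - δ / n - δ / (C * n) := by field_simp; ring
    rw [e]; linarith
  have h0 : 0 ≤ (1 - (1 + 1 / (C : ℝ)) / n) * δ := by
    apply mul_nonneg _ hδ0.le
    have : (1 + 1 / (C : ℝ)) / n ≤ 1 := by rw [div_le_one hn']; exact hq
    linarith
  rw [← mul_pow]
  calc ((1 - (1 + 1 / (C : ℝ)) / n) * δ) ^ n
      = ((1 - (1 + 1 / (C : ℝ)) / n) * δ) ^ (n - r) * ((1 - (1 + 1 / (C : ℝ)) / n) * δ) ^ r := by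
        rw [← pow_add, Nat.sub_add_cancel hr]
    _ ≤ _ := by
        have : 0 ≤ (δ : ℝ) - q := by linarith
        gcongr
        linarith

/-- Each factor `δ - x` is at most `δ * exp (-x / δ)`, and the numbers `x` sum to `δ`. -/
theorem balanced_prod_le {n δ q r : ℕ} (hδ0 : 0 < δ) (hδ : δ = q * n + r) (hr : r ≤ n)
    (hq : q + 1 ≤ δ) :
    ((δ : ℝ) - q) ^ (n - r) * ((δ : ℝ) - q - 1) ^ r ≤ Real.exp (-1) * (δ : ℝ) ^ n := by
  have hδ' : (0 : ℝ) < δ := by exact_mod_cast hδ0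
  have hq' : (q : ℝ) + 1 ≤ δ := by exact_mod_cast hq
  have key : ∀ x : ℝ, (δ : ℝ) - x ≤ δ * Real.exp (-(x / δ)) := by
    intro x
    have := Real.add_one_le_exp (-(x / δ))
    calc (δ : ℝ) - x = δ * (-(x / δ) + 1) := by field_simp; ring
      _ ≤ _ := by gcongr
  have k2 := key (q + 1)
  rw [← sub_sub] at k2
  have h1 : 0 ≤ (δ : ℝ) - q := by linarith
  have h2 : 0 ≤ (δ : ℝ) - q - 1 := by linarith
  calc ((δ : ℝ) - q) ^ (n - r) * ((δ : ℝ) - q - 1) ^ r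
      ≤ (δ * Real.exp (-(q / δ))) ^ (n - r) * (δ * Real.exp (-((q + 1) / δ))) ^ r := by
        gcongr
        exact key _
    _ = Real.exp (-1) * (δ : ℝ) ^ n := by
        rw [mul_pow, mul_pow, ← Real.exp_nat_mul, ← Real.exp_nat_mul]
        have e : (δ : ℝ) ^ n = δ ^ (n - r) * δ ^ r := by rw [← pow_add, Nat.sub_add_cancel hr]
        have e2 : Real.exp (-1) = Real.exp (((n - r : ℕ) : ℝ) * -(q / δ)) *
            Real.exp ((r : ℝ) * -((q + 1) / δ)) := by
          rw [← Real.exp_add]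
          congr 1
          have : (δ : ℝ) = q * n + r := by exact_mod_cast hδ
          rw [Nat.cast_sub hr]
          field_simp
          rw [this]; ring
        rw [e, e2]; ring

theorem exists_one_sub_div_pow_ge {ε : ℝ} (hε : 0 < ε) :
    ∃ m : ℕ, 4 ≤ m ∧ Real.exp (-1) - ε ≤ (1 - (1 + 1 / (m : ℝ)) / m) ^ m := by
  have h : Filter.Tendsto (fun m : ℕ => (m : ℝ) * -((1 + 1 / (m : ℝ)) / m)) Filter.atTop
      (nhds (-1)) := by
    have h1 : Filter.Tendsto (fun m : ℕ => -(1 + 1 / (m : ℝ))) Filter.atTop (nhds (-(1 + 0))) :=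
      (tendsto_const_nhds.add tendsto_one_div_atTop_nhds_zero_nat).neg
    rw [add_zero] at h1
    refine h1.congr' ?_
    filter_upwards [Filter.eventually_gt_atTop 0] with m hm
    have : (m : ℝ) ≠ 0 := by positivity
    field_simp
  have h2 := Real.tendsto_one_add_pow_exp_of_tendsto h
  have h3 := h2.eventually (lt_mem_nhds (show Real.exp (-1) - ε < Real.exp (-1) by linarith))
  obtain ⟨m, hm, hm4⟩ := (h3.and (Filter.eventually_ge_atTop 4)).exists
  exact ⟨m, hm4, by rw [sub_eq_add_neg 1]; exact hm.le⟩

open Finset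

/-! ### Transversal sets and blocking families -/

section Blocking

variable {ι α : Type*}

theorem eq_of_mem_of_mem {s : Finset ι} {U : ι → Finset α} (hU : (s : Set ι).PairwiseDisjoint U)
    {i j : ι} (hi : i ∈ s) (hj : j ∈ s) {x : α} (hxi : x ∈ U i) (hxj : x ∈ U j) : i = j :=
  hU.elim_finset hi hj x hxi hxj

theorem injOn_of_mem_disjoint {s : Finset ι} {U : ι → Finset α}
    (hU : (s : Set ι).PairwiseDisjoint U) {c : ι → α} (hc : ∀ i ∈ s, c i ∈ U i) :
    Set.InjOn c s := fun i hi j hj h =>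
  eq_of_mem_of_mem hU hi hj (hc i hi) (h ▸ hc j hj)

variable [DecidableEq α]

open Classical in
/-- The sets `{c i | i ∈ s}` obtained by choosing one point `c i` of every `U i`, `i ∈ s`. -/
noncomputable def transversalSets (s : Finset ι) (U : ι → Finset α) : Finset (Finset α) :=
  {f ∈ (s.biUnion U).powerset | ∃ c : ι → α, (∀ i ∈ s, c i ∈ U i) ∧ s.image c = f}

theorem mem_transversalSets {s : Finset ι} {U : ι → Finset α} {f : Finset α} :
    f ∈ transversalSets s U ↔ ∃ c : ι → α, (∀ i ∈ s, c i ∈ U i) ∧ s.image c = f := by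
  classical
  simp only [transversalSets, mem_filter, mem_powerset, and_iff_right_iff_imp]
  rintro ⟨c, hc, rfl⟩ x hx
  obtain ⟨i, hi, rfl⟩ := mem_image.1 hx
  exact mem_biUnion.2 ⟨i, hi, hc i hi⟩

theorem card_transversalSets [Nonempty α] [DecidableEq ι] {s : Finset ι} {U : ι → Finset α}
    (hU : (s : Set ι).PairwiseDisjoint U) :
    (transversalSets s U).card = ∏ i ∈ s, (U i).card := by
  classical
  rw [← card_pi]
  symm
  refine card_bij (fun c _ => s.attach.image fun i => c i.1 i.2) ?_ ?_ ?_
  · intro c hc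
    rw [mem_pi] at hc
    refine mem_transversalSets.2
      ⟨fun i => if h : i ∈ s then c i h else Classical.arbitrary α, fun i hi => ?_, ?_⟩
    · simpa [hi] using hc i hi
    · ext x
      simp only [mem_image, mem_attach, true_and, Subtype.exists]
      constructor
      · rintro ⟨i, hi, rfl⟩; exact ⟨i, hi, by simp [hi]⟩
      · rintro ⟨i, hi, rfl⟩; exact ⟨i, hi, by simp [hi]⟩
  · intro c hc d hd h
    rw [mem_pi] at hc hd
    ext i hi
    have : c i hi ∈ s.attach.image fun i => d i.1 i.2 := by
      rw [← h]; exact mem_image.2 ⟨⟨i, hi⟩, mem_attach _ _, rfl⟩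
    obtain ⟨⟨j, hj⟩, -, h2⟩ := mem_image.1 this
    simp only at h2
    obtain rfl : j = i := eq_of_mem_of_mem hU hj hi (hd j hj) (h2 ▸ hc i hi)
    exact h2.symm
  · intro f hf
    obtain ⟨c, hc, rfl⟩ := mem_transversalSets.1 hf
    exact ⟨fun i _ => c i, mem_pi.2 hc, by ext x; simp⟩

theorem disjoint_transversalSets {s t : Finset ι} {U V : ι → Finset α} {m : ι} (hm : m ∈ s)
    (h : ∀ p ∈ t, Disjoint (U m) (V p)) : Disjoint (transversalSets s U) (transversalSets t V) := by
  refine disjoint_left.2 fun f hf hf' => ?_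
  obtain ⟨c, hc, rfl⟩ := mem_transversalSets.1 hf
  obtain ⟨d, hd, he⟩ := mem_transversalSets.1 hf'
  have h1 : c m ∈ t.image d := he ▸ mem_image.2 ⟨m, hm, rfl⟩
  obtain ⟨p, hp, hpm⟩ := mem_image.1 h1
  exact disjoint_left.1 (h p hp) (hc m hm) (hpm ▸ hd p hp)

variable [Fintype ι]

/-- The family `F` blocks the lists `S` if each way of choosing one point from every list uses all
points of some member of `F`. -/
def Blocks (F : Finset (Finset α)) (S : ι → Finset α) : Prop :=
  ∀ c : ι → α, (∀ i, c i ∈ S i) → ∃ f ∈ F, f ⊆ univ.image c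

variable {F : Finset (Finset α)} {S : ι → Finset α}

/-- Transversal sets as small as the members of `F` belong to `F` if they come from a choice from
all lists. -/
theorem Blocks.mem_of_card {n : ℕ} (hB : Blocks F S) (hF : ∀ f ∈ F, f.card = n) {c : ι → α}
    (hc : ∀ i, c i ∈ S i) {f : Finset α} (hf : univ.image c ⊆ f) (hfn : f.card ≤ n) : f ∈ F := by
  obtain ⟨g, hg, hgc⟩ := hB c hc
  have : g = f := eq_of_subset_of_card_le (hgc.trans hf) (by rw [hF g hg]; exact hfn)
  exact this ▸ hg

variable [DecidableEq ι]

/-- The points of `S i` that lie in no other list. -/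
def privatePart (S : ι → Finset α) (i : ι) : Finset α := S i \ (univ.erase i).biUnion S

theorem mem_privatePart {i : ι} {x : α} :
    x ∈ privatePart S i ↔ x ∈ S i ∧ ∀ j, j ≠ i → x ∉ S j := by
  simp [privatePart]

theorem pairwiseDisjoint_privatePart (s : Set ι) : s.PairwiseDisjoint (privatePart S) := by
  intro i _ j _ hij
  refine disjoint_left.2 fun x hi hj => ?_
  exact (mem_privatePart.1 hi).2 j hij.symm (mem_privatePart.1 hj).1

/-- A choice in which the points of the indices in `s` are also used outside `s` has few points;
if a uniform family blocks `S`, its members are no larger than that. -/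
theorem Blocks.le_card_compl {n : ℕ} (hB : Blocks F S) (hF : ∀ f ∈ F, f.card = n) {c : ι → α}
    (hc : ∀ i, c i ∈ S i) (s : Finset ι) (hs : ∀ i ∈ s, ∃ j ∉ s, c j = c i) :
    n ≤ sᶜ.card := by
  obtain ⟨f, hf, hfc⟩ := hB c hc
  rw [← hF f hf]
  refine (card_le_card ?_).trans (card_image_le (s := sᶜ) (f := c))
  intro x hx
  obtain ⟨i, -, rfl⟩ := mem_image.1 (hfc hx)
  by_cases hi : i ∈ s
  · obtain ⟨j, hj, h⟩ := hs i hi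
    exact mem_image.2 ⟨j, mem_compl.2 hj, h⟩
  · exact mem_image.2 ⟨i, mem_compl.2 hi, rfl⟩

theorem Blocks.not_mem_three {n : ℕ} (hB : Blocks F S) (hF : ∀ f ∈ F, f.card = n)
    (hn : Fintype.card ι = n + 1) (hS : ∀ i, (S i).Nonempty) {i j l : ι} (hij : i ≠ j)
    (hil : i ≠ l) (hjl : j ≠ l) {x : α} (hi : x ∈ S i) (hj : x ∈ S j) : x ∉ S l := by
  intro hl
  choose c hc using hS
  have hc' : ∀ m, (fun m => if m = i ∨ m = j ∨ m = l then x else c m) m ∈ S m := by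
    intro m
    dsimp only
    split_ifs with h
    · rcases h with rfl | rfl | rfl <;> assumption
    · exact hc m
  have := hB.le_card_compl hF hc' {j, l} (fun m hm => ⟨i, by simp [hij, hil], by
        rcases mem_insert.1 hm with rfl | hm
        · simp
        · simp [mem_singleton.1 hm]⟩)
  have h2 := card_le_univ {j, l}
  rw [card_compl, card_pair hjl] at this
  rw [card_pair hjl] at h2
  omega

theorem Blocks.not_disjoint_pairs {n : ℕ} (hB : Blocks F S) (hF : ∀ f ∈ F, f.card = n)
    (hn : Fintype.card ι = n + 1) (hS : ∀ i, (S i).Nonempty) {i j l m : ι} (hij : i ≠ j)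
    (hlm : l ≠ m) (hil : i ≠ l) (him : i ≠ m) (hjl : j ≠ l) (hjm : j ≠ m)
    (h1 : ¬ Disjoint (S i) (S j)) : Disjoint (S l) (S m) := by
  by_contra h2
  obtain ⟨x, hxi, hxj⟩ := not_disjoint_iff.1 h1
  obtain ⟨y, hyl, hym⟩ := not_disjoint_iff.1 h2
  choose c hc using hS
  have hc' : ∀ p, (fun p => if p = i ∨ p = j then x else if p = l ∨ p = m then y else c p) p
      ∈ S p := by
    intro p
    dsimp only
    split_ifs with h h'
    · rcases h with rfl | rfl <;> assumption
    · rcases h' with rfl | rfl <;> assumption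
    · exact hc p
  have := hB.le_card_compl hF hc' {j, m} (fun p hp => by
        rcases mem_insert.1 hp with rfl | hp
        · exact ⟨i, by simp [hij, him], by simp⟩
        · obtain rfl := mem_singleton.1 hp
          exact ⟨l, by simp [hlm, hjl.symm], by
            simp [hil.symm, hjl.symm, him.symm, hjm.symm]⟩)
  have h2 := card_le_univ {j, m}
  rw [card_compl, card_pair hjm] at this
  rw [card_pair hjm] at h2
  omega

/-- Any two intersecting pairs of blocked lists share a list, so these pairs form a star or a
triangle. -/
theorem Blocks.star_or_triangle [Nonempty ι] {n : ℕ} (hB : Blocks F S) (hF : ∀ f ∈ F, f.card = n)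
    (hn : Fintype.card ι = n + 1) (hS : ∀ i, (S i).Nonempty) :
    (∃ k, ({k}ᶜ : Set ι).PairwiseDisjoint S) ∨
    ∃ i j l, i ≠ j ∧ i ≠ l ∧ j ≠ l ∧
      ∀ p p', p ≠ p' → p ∉ ({i, j, l} : Finset ι) → Disjoint (S p) (S p') := by
  by_contra! hcon
  obtain ⟨hstar, htri⟩ := hcon
  have edge : ∀ k, ∃ i j, i ≠ k ∧ j ≠ k ∧ i ≠ j ∧ ¬ Disjoint (S i) (S j) := by
    intro k
    have := hstar k
    simp only [Set.PairwiseDisjoint, Set.Pairwise, not_forall] at this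
    obtain ⟨i, hi, j, hj, hij, h⟩ := this
    exact ⟨i, j, by simpa using hi, by simpa using hj, hij, h⟩
  have meet : ∀ {i j l m : ι}, i ≠ j → l ≠ m → ¬ Disjoint (S i) (S j) → ¬ Disjoint (S l) (S m) →
      i = l ∨ i = m ∨ j = l ∨ j = m := by
    intro i j l m hij hlm h1 h2
    by_contra! h
    exact h2 (hB.not_disjoint_pairs hF hn hS hij hlm h.1 h.2.1 h.2.2.1 h.2.2.2 h1)
  obtain ⟨k⟩ := ‹Nonempty ι›
  obtain ⟨i, j, -, -, hij, h1⟩ := edge k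
  obtain ⟨l, hli, hlj, h2⟩ : ∃ l, l ≠ i ∧ l ≠ j ∧ ¬ Disjoint (S j) (S l) := by
    obtain ⟨p, p', hp, hp', hpp, h⟩ := edge i
    rcases meet hij hpp h1 h with rfl | rfl | rfl | rfl
    · exact absurd rfl hp
    · exact absurd rfl hp'
    · exact ⟨p', hp', hpp.symm, h⟩
    · exact ⟨p, hp, hpp, fun h' => h h'.symm⟩
  have h3 : ¬ Disjoint (S i) (S l) := by
    obtain ⟨p, p', hp, hp', hpp, h⟩ := edge j
    have a1 := meet hij hpp h1 h
    have a2 := meet hlj.symm hpp h2 h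
    rcases a1 with rfl | rfl | rfl | rfl
    · rcases a2 with rfl | rfl | rfl | rfl
      · exact absurd rfl hp
      · exact absurd rfl hp'
      · exact absurd rfl hli
      · exact h
    · rcases a2 with rfl | rfl | rfl | rfl
      · exact absurd rfl hp
      · exact absurd rfl hp'
      · exact fun h' => h h'.symm
      · exact absurd rfl hli
    · exact absurd rfl hp
    · exact absurd rfl hp'
  obtain ⟨p, p', hpp, hp, h⟩ := htri i j l hij hli.symm hlj.symm
  simp only [mem_insert, mem_singleton, not_or] at hp
  have a1 := meet hij hpp h1 h
  have a2 := meet hlj.symm hpp h2 h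
  have a3 := meet hli.symm hpp h3 h
  grind

/-- The members of `F` inside the private parts: each of them omits one part `j`, so it serves at
most `|Y j|` of the `∏ |Y i|` choices. -/
theorem Blocks.prod_le_mul_card {n : ℕ} (hB : Blocks F S) (hF : ∀ f ∈ F, f.card = n)
    (hn : Fintype.card ι = n + 1) {m : ℕ} (hm : ∀ i, (privatePart S i).card ≤ m) :
    ∏ i, (privatePart S i).card ≤
      m * {f ∈ F | f ⊆ univ.biUnion (privatePart S)}.card := by
  classical
  have hex : ∀ c : ι → α, ∃ f, c ∈ Fintype.piFinset (privatePart S) →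
      f ∈ F ∧ f ⊆ univ.image c := by
    intro c
    by_cases h : c ∈ Fintype.piFinset (privatePart S)
    · obtain ⟨f, hf, hfc⟩ := hB c fun i => (mem_privatePart.1 (Fintype.mem_piFinset.1 h i)).1
      exact ⟨f, fun _ => ⟨hf, hfc⟩⟩
    · exact ⟨∅, fun h' => absurd h' h⟩
  choose φ hφ using hex
  rw [← Fintype.card_piFinset]
  refine (card_le_mul_card_image (f := φ) _ m ?_).trans (Nat.mul_le_mul_left m (card_le_card ?_))
  · intro f hf
    obtain ⟨c₀, hc₀, rfl⟩ := mem_image.1 hf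
    obtain ⟨hfF, hfc⟩ := hφ c₀ hc₀
    have hc₀' := Fintype.mem_piFinset.1 hc₀
    -- the part omitted by this member of `F`
    obtain ⟨j, hj⟩ : ∃ j, c₀ j ∉ φ c₀ := by
      by_contra! h
      have h1 : univ.image c₀ ⊆ φ c₀ := by
        intro x hx
        obtain ⟨i, -, rfl⟩ := mem_image.1 hx
        exact h i
      have h2 := card_le_card h1
      rw [card_image_of_injective _ (fun a b hab => injOn_of_mem_disjoint (s := univ)
        (pairwiseDisjoint_privatePart _) (fun i _ => hc₀' i) (mem_univ a) (mem_univ b) hab),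
        card_univ, hn, hF _ hfF] at h2
      omega
    have hall : ∀ i, i ≠ j → c₀ i ∈ φ c₀ := by
      have h1 : φ c₀ = (univ.erase j).image c₀ := by
        refine eq_of_subset_of_card_le ?_ ?_
        · intro x hx
          obtain ⟨i, -, rfl⟩ := mem_image.1 (hfc hx)
          exact mem_image.2 ⟨i, by
            simp only [mem_erase, mem_univ, and_true]
            rintro rfl; exact hj hx, rfl⟩
        · refine card_image_le.trans ?_
          rw [hF _ hfF, card_erase_of_mem (mem_univ _), card_univ, hn, Nat.add_sub_cancel]
      intro i hi
      rw [h1]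
      exact mem_image.2 ⟨i, by simp [hi], rfl⟩
    refine (card_le_card_of_injOn (t := privatePart S j) (fun c => c j) ?_ ?_).trans (hm j)
    · intro c hc
      exact Fintype.mem_piFinset.1 (mem_filter.1 hc).1 j
    · have hagree : ∀ c, c ∈ Fintype.piFinset (privatePart S) → φ c = φ c₀ →
          ∀ i, i ≠ j → c i = c₀ i := by
        intro c hc hcf i hi
        have h1 : c₀ i ∈ univ.image c := (hφ c hc).2 (hcf ▸ hall i hi)
        obtain ⟨i', -, h2⟩ := mem_image.1 h1
        have h3 : i' = i := eq_of_mem_of_mem (s := univ) (U := privatePart S)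
          (pairwiseDisjoint_privatePart _) (mem_univ _) (mem_univ _)
          (Fintype.mem_piFinset.1 hc i') (h2 ▸ hc₀' i)
        rw [← h3, h2, h3]
      intro c hc d hd hcd
      obtain ⟨hc1, hc2⟩ := mem_filter.1 hc
      obtain ⟨hd1, hd2⟩ := mem_filter.1 hd
      funext i
      by_cases hi : i = j
      · rw [hi]; exact hcd
      · rw [hagree c hc1 hc2 i hi, hagree d hd1 hd2 i hi]
  · intro f hf
    obtain ⟨c, hc, rfl⟩ := mem_image.1 hf
    obtain ⟨h1, h2⟩ := hφ c hc
    refine mem_filter.2 ⟨h1, fun x hx => ?_⟩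
    obtain ⟨i, -, rfl⟩ := mem_image.1 (h2 hx)
    exact mem_biUnion.2 ⟨i, mem_univ _, Fintype.mem_piFinset.1 hc i⟩

/-- Sets that meet a non-private part are counted apart from those inside the private parts. -/
theorem Blocks.add_prod_erase_le_card [Nontrivial ι] {n : ℕ} (hB : Blocks F S)
    (hF : ∀ f ∈ F, f.card = n) (hn : Fintype.card ι = n + 1) {j : ι}
    (hj : ∀ i, (privatePart S i).card ≤ (privatePart S j).card) {G : Finset (Finset α)}
    (hGF : G ⊆ F) (hG : ∀ f ∈ G, ¬ f ⊆ univ.biUnion (privatePart S)) :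
    G.card + ∏ i ∈ univ.erase j, (privatePart S i).card ≤ F.card := by
  have h1 : ∏ i ∈ univ.erase j, (privatePart S i).card ≤
      {f ∈ F | f ⊆ univ.biUnion (privatePart S)}.card := by
    have h2 := hB.prod_le_mul_card hF hn hj
    rw [← mul_prod_erase _ _ (mem_univ j)] at h2
    rcases Nat.eq_zero_or_pos (privatePart S j).card with h0 | h0
    · obtain ⟨i, hi⟩ := exists_ne j
      rw [prod_eq_zero (i := i) (by simp [hi])]
      · exact Nat.zero_le _
      · have := hj i; omega
    · exact Nat.le_of_mul_le_mul_left h2 h0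
  have hd : Disjoint G {f ∈ F | f ⊆ univ.biUnion (privatePart S)} :=
    disjoint_left.2 fun f hf hf' => hG f hf (mem_filter.1 hf').2
  calc _ ≤ G.card + {f ∈ F | f ⊆ univ.biUnion (privatePart S)}.card := by omega
    _ = _ := (card_union_of_disjoint hd).symm
    _ ≤ F.card := card_le_card (union_subset hGF (filter_subset _ _))

end Blocking

/-! ### Triangles of lists and forced members of a blocking family -/

section Bounds

variable {ι α : Type*} [DecidableEq ι] {S : ι → Finset α}

/-- The lists `i`, `j`, `l` are the only ones that may intersect, and have no common point. -/
structure IsTriangle (S : ι → Finset α) (i j l : ι) : Prop where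
  ij : i ≠ j
  il : i ≠ l
  jl : j ≠ l
  disj : ∀ p p', p ≠ p' → p ∉ ({i, j, l} : Finset ι) → Disjoint (S p) (S p')
  no_common : ∀ x, x ∈ S i → x ∈ S j → x ∉ S l

namespace IsTriangle

variable {i j l : ι}

theorem rotate (h : IsTriangle S i j l) : IsTriangle S j l i where
  ij := h.jl
  il := h.ij.symm
  jl := h.il.symm
  disj p p' hp hp' := h.disj p p' hp (by
    simp only [mem_insert, mem_singleton] at hp' ⊢; tauto)
  no_common x hj hl hi := h.no_common x hi hj hl

theorem notMem (h : IsTriangle S i j l) {p q : ι} (hp : p ∉ ({i, j, l} : Finset ι)) (hpq : p ≠ q)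
    {x : α} (hx : x ∈ S p) : x ∉ S q :=
  disjoint_left.1 (h.disj p q hpq hp) hx

variable [Fintype ι]

theorem erase_eq (h : IsTriangle S i j l) :
    univ.erase l = insert i (insert j ({i, j, l} : Finset ι)ᶜ) := by
  have := h.ij; have := h.il; have := h.jl
  ext p
  simp only [mem_erase, mem_univ, and_true, mem_insert, mem_compl, mem_singleton]
  grind

theorem card_compl (h : IsTriangle S i j l) {n : ℕ} (hn : Fintype.card ι = n + 1) :
    ({i, j, l} : Finset ι)ᶜ.card = n - 2 := by
  rw [Finset.card_compl, card_eq_three.2 ⟨i, j, l, h.ij, h.il, h.jl, rfl⟩, hn]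
  omega

end IsTriangle

variable [DecidableEq α] [Fintype ι] {F : Finset (Finset α)}

/-- A point common to the lists `m` and `k` serves both, so `F` contains every set that consists of
such a point and one point from each of the other lists. -/
theorem Blocks.image_erase_mem {n : ℕ} (hB : Blocks F S) (hF : ∀ f ∈ F, f.card = n)
    (hn : Fintype.card ι = n + 1) {k m : ι} (hmk : m ≠ k) {c : ι → α}
    (hc : ∀ i, i ≠ k → c i ∈ S i) (hm : c m ∈ S k) : (univ.erase k).image c ∈ F := by
  have hc' : ∀ i, Function.update c k (c m) i ∈ S i := by
    intro i
    by_cases h : i = k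
    · subst h; simpa using hm
    · simpa [h] using hc i h
  refine hB.mem_of_card hF hc' ?_ ?_
  · intro x hx
    obtain ⟨i, -, rfl⟩ := mem_image.1 hx
    by_cases h : i = k
    · subst h
      exact mem_image.2 ⟨m, by simp [hmk], by simp⟩
    · exact mem_image.2 ⟨i, by simp [h], by simp [h]⟩
  · refine card_image_le.trans ?_
    rw [card_erase_of_mem (mem_univ _), card_univ, hn, Nat.add_sub_cancel]

theorem notMem_biUnion_privatePart {i j : ι} (hij : i ≠ j) {x : α} (hi : x ∈ S i) (hj : x ∈ S j) :
    x ∉ univ.biUnion (privatePart S) := by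
  intro h
  obtain ⟨p, -, hp⟩ := mem_biUnion.1 h
  have h2 := (mem_privatePart.1 hp).2
  by_cases hpi : i = p
  · exact h2 j (by rintro rfl; exact hij hpi) hj
  · exact h2 i hpi hi

/-! ### Intersections forming a star -/

/-- In a star with centre `k`, the lists other than `S k` and their private parts determine the
private part of `S k`. -/
theorem card_privatePart_star {δ : ℕ} (hδ : ∀ i, (S i).card = δ) {k : ι}
    (hk : ({k}ᶜ : Set ι).PairwiseDisjoint S) :
    ∃ x : ι → ℕ, (∀ i, i ≠ k → (privatePart S i).card + x i = δ) ∧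
      (privatePart S k).card + ∑ i ∈ univ.erase k, x i = δ := by
  refine ⟨fun i => (S i ∩ S k).card, fun i hi => ?_, ?_⟩
  · have h : privatePart S i = S i \ S k := by
      ext x
      rw [mem_privatePart, mem_sdiff]
      refine and_congr_right fun hx => ⟨fun h => h k hi.symm, fun h j hj hxj => ?_⟩
      by_cases hjk : j = k
      · subst hjk; exact h hxj
      · exact disjoint_left.1 (hk (by simpa using hi) (by simpa using hjk) hj.symm) hx hxj
    rw [h, card_sdiff_add_card_inter, hδ]
  · have h : ∑ i ∈ univ.erase k, (S i ∩ S k).card = (S k ∩ (univ.erase k).biUnion S).card := by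
      rw [← card_biUnion]
      · congr 1
        ext x
        simp only [mem_biUnion, mem_inter]
        grind
      · intro i hi j hj hij
        exact (hk (by simpa using hi) (by simpa using hj) hij).mono inter_subset_left
          inter_subset_left
    rw [h, privatePart, card_sdiff_add_card_inter, hδ]

/-- The choices from the lists other than `S k` that are not wholly private give
`δ ^ n - ∏_{i ≠ k} |Y i|` members of `F`, where `Y i` is the private part of `S i`. The members inside
the private parts number at least `∏_{i ≠ j} |Y i|`, where `Y j` is largest. The difference of the two
products is a product of `n` numbers with sum `(n - 1) * δ`. -/
theorem Blocks.star_bound [Nontrivial ι] {n δ v r : ℕ} (hB : Blocks F S)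
    (hF : ∀ f ∈ F, f.card = n) (hn : Fintype.card ι = n + 1) (hδ : ∀ i, (S i).card = δ) {k : ι}
    (hk : ({k}ᶜ : Set ι).PairwiseDisjoint S) (hv : 2 ≤ v) (hr : r ≤ n)
    (hsum : (n - 1) * δ + r = n * v) :
    δ ^ n ≤ F.card + v ^ (n - r) * (v - 1) ^ r := by
  have hα : Nonempty α ∨ δ = 0 := by
    rcases Nat.eq_zero_or_pos δ with h | h
    · exact Or.inr h
    · obtain ⟨x, -⟩ := card_pos.1 (by rw [hδ k]; exact h)
      exact Or.inl ⟨x⟩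
  have hcard : (univ.erase k).card = n := by
    rw [card_erase_of_mem (mem_univ _), card_univ, hn, Nat.add_sub_cancel]
  have hn1 : 1 ≤ n := by
    have := Fintype.one_lt_card (α := ι); omega
  rcases hα with hα | rfl
  swap
  · rw [zero_pow (by omega)]; exact Nat.zero_le _
  have hpd : ((univ.erase k : Finset ι) : Set ι).PairwiseDisjoint S :=
    hk.subset fun i hi => by simpa using hi
  obtain ⟨G, hG⟩ : ∃ G, G = transversalSets (univ.erase k) S \
    transversalSets (univ.erase k) (privatePart S) := ⟨_, rfl⟩
  have hsub : transversalSets (univ.erase k) (privatePart S) ⊆ transversalSets (univ.erase k) S := by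
    intro f hf
    obtain ⟨c, hc, rfl⟩ := mem_transversalSets.1 hf
    exact mem_transversalSets.2 ⟨c, fun i hi => (mem_privatePart.1 (hc i hi)).1, rfl⟩
  have hGcard : G.card + ∏ i ∈ univ.erase k, (privatePart S i).card = δ ^ n := by
    have := card_sdiff_add_card_eq_card hsub
    rw [← hG, card_transversalSets hpd, card_transversalSets (pairwiseDisjoint_privatePart _),
      prod_congr rfl fun i _ => hδ i, prod_const, hcard] at this
    exact this
  -- a set of `G` has a point in the centre, which can be chosen there as well
  have hGc : ∀ f ∈ G, ∃ c : ι → α, ∃ i, i ≠ k ∧ (∀ j, j ≠ k → c j ∈ S j) ∧ c i ∈ S k ∧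
      (univ.erase k).image c = f := by
    intro f hf
    rw [hG, mem_sdiff] at hf
    obtain ⟨c, hc, rfl⟩ := mem_transversalSets.1 hf.1
    have hc' : ∀ j, j ≠ k → c j ∈ S j := fun j hj => hc j (by simp [hj])
    by_contra! hcon
    refine hf.2 (mem_transversalSets.2 ⟨c, fun i hi => mem_privatePart.2 ⟨hc i hi, ?_⟩, rfl⟩)
    have hik : i ≠ k := by simpa using hi
    intro j hji hj
    by_cases hjk : j = k
    · exact hcon c i hik hc' (hjk ▸ hj) rfl
    · exact hji (eq_of_mem_of_mem hpd (by simp [hjk]) hi hj (hc i hi))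
  have hGF : G ⊆ F := by
    intro f hf
    obtain ⟨c, i, hik, hc, hi, rfl⟩ := hGc f hf
    exact hB.image_erase_mem hF hn hik hc hi
  have hGp : ∀ f ∈ G, ¬ f ⊆ univ.biUnion (privatePart S) := by
    intro f hf hsub
    obtain ⟨c, i, hik, hc, hi, rfl⟩ := hGc f hf
    exact notMem_biUnion_privatePart hik (hc i hik) hi
      (hsub (mem_image.2 ⟨i, by simp [hik], rfl⟩))
  obtain ⟨x, hx, hxk⟩ := card_privatePart_star hδ hk
  obtain ⟨j, -, hj⟩ := exists_max_image univ (fun i => (privatePart S i).card) univ_nonempty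
  have hmain := hB.add_prod_erase_le_card hF hn (fun i => hj i (mem_univ _)) hGF hGp
  by_cases hjk : j = k
  · subst hjk
    omega
  · have hmem : j ∈ univ.erase k := by simp [hjk]
    have hmem' : k ∈ univ.erase j := by simp [Ne.symm hjk]
    have hcard' : ((univ.erase k).erase j).card = n - 1 := by rw [card_erase_of_mem hmem, hcard]
    obtain ⟨t, ht⟩ : ∃ t, t = ∑ i ∈ (univ.erase k).erase j, x i := ⟨_, rfl⟩
    obtain ⟨Q, hQ⟩ : ∃ Q, Q = ∏ i ∈ (univ.erase k).erase j, (privatePart S i).card := ⟨_, rfl⟩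
    rw [← mul_prod_erase _ _ hmem', erase_right_comm, ← hQ] at hmain
    rw [← mul_prod_erase _ _ hmem, ← hQ] at hGcard
    rw [← add_sum_erase _ _ hmem, ← ht] at hxk
    have hyj : (privatePart S j).card = (privatePart S k).card + t := by
      have := hx j hjk; omega
    -- `t` and the `n - 1` sizes in `Q` are `n` numbers with the balanced sum
    have hP : t * Q ≤ v ^ (n - r) * (v - 1) ^ r := by
      have := prod_le_balanced (univ.erase k)
        (Function.update (fun i => (privatePart S i).card) j t) (v := v) (r := r) hv
        (by rw [hcard]; exact hr) (by
          rw [sum_update_of_mem hmem, sdiff_singleton_eq_erase, ht, ← sum_add_distrib,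
            sum_congr rfl (g := fun _ => δ), sum_const, hcard', smul_eq_mul, hcard, hsum]
          intro i hi
          simp only [mem_erase] at hi
          rw [add_comm]; exact hx i hi.2.1)
      rwa [prod_update_of_mem hmem, sdiff_singleton_eq_erase, ← hQ, hcard] at this
    calc δ ^ n = G.card + (privatePart S k).card * Q + t * Q := by rw [← hGcard, hyj]; ring
      _ ≤ _ := Nat.add_le_add hmain hP

/-! ### Intersections forming a triangle -/

namespace IsTriangle

variable {i j l : ι}

theorem card_privatePart (h : IsTriangle S i j l) {δ : ℕ} (hδ : ∀ i, (S i).card = δ) :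
    (privatePart S i).card + (S i ∩ S j).card + (S i ∩ S l).card = δ := by
  have h1 : S i ∩ (univ.erase i).biUnion S = (S i ∩ S j) ∪ (S i ∩ S l) := by
    ext x
    simp only [mem_inter, mem_biUnion, mem_union, mem_erase, mem_univ, and_true]
    constructor
    · rintro ⟨hx, p, hp, hxp⟩
      by_cases hm : p ∈ ({i, j, l} : Finset ι)
      · simp only [mem_insert, mem_singleton] at hm
        rcases hm with rfl | rfl | rfl
        · exact absurd rfl hp
        · exact Or.inl ⟨hx, hxp⟩
        · exact Or.inr ⟨hx, hxp⟩
      · exact absurd hx (h.notMem hm hp hxp)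
    · rintro (⟨hx, hy⟩ | ⟨hx, hy⟩)
      · exact ⟨hx, j, h.ij.symm, hy⟩
      · exact ⟨hx, l, h.il.symm, hy⟩
  rw [add_assoc, ← card_union_of_disjoint, ← h1, privatePart, card_sdiff_add_card_inter, hδ]
  refine disjoint_left.2 fun x hx hx' => ?_
  simp only [mem_inter] at hx hx'
  exact h.no_common x hx.1 hx.2 hx'.2

theorem privatePart_eq (h : IsTriangle S i j l) {p : ι} (hp : p ∉ ({i, j, l} : Finset ι)) :
    privatePart S p = S p := by
  ext x
  rw [mem_privatePart]
  exact ⟨And.left, fun hx => ⟨hx, fun q hq => h.notMem hp hq.symm hx⟩⟩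

theorem card_transversalSets (h : IsTriangle S i j l) {n δ : ℕ} (hn : Fintype.card ι = n + 1)
    [Nonempty α] (hδ : ∀ i, (S i).card = δ) {U : ι → Finset α} (hU : ∀ p, U p ⊆ S p)
    (hUij : Disjoint (U i) (U j)) (hUS : ∀ p ∉ ({i, j, l} : Finset ι), U p = S p) :
    (transversalSets (univ.erase l) U).card = (U i).card * (U j).card * δ ^ (n - 2) := by
  rw [_root_.card_transversalSets, h.erase_eq, prod_insert (by simp [h.ij]),
    prod_insert (by simp), ← mul_assoc, prod_congr rfl (g := fun _ => δ), prod_const,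
    h.card_compl hn]
  · intro p hp
    rw [hUS p (mem_compl.1 hp), hδ]
  · intro p hp p' hp' hpp
    by_cases h1 : p ∈ ({i, j, l} : Finset ι)
    · by_cases h2 : p' ∈ ({i, j, l} : Finset ι)
      · simp only [mem_insert, mem_singleton, coe_erase, coe_univ, Set.mem_sdiff, Set.mem_univ,
          Set.mem_singleton_iff, true_and] at h1 h2 hp hp'
        rcases h1 with rfl | rfl | rfl <;> rcases h2 with rfl | rfl | rfl <;>
          first
          | exact absurd rfl hpp
          | exact absurd rfl hp
          | exact absurd rfl hp'
          | exact hUij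
          | exact hUij.symm
      · exact ((h.disj p' p hpp.symm h2).mono (hU _) (hU _)).symm
    · exact (h.disj p p' hpp h1).mono (hU _) (hU _)

end IsTriangle

theorem Blocks.transversalSets_subset {n : ℕ} (hB : Blocks F S) (hF : ∀ f ∈ F, f.card = n)
    (hn : Fintype.card ι = n + 1) {k m : ι} (hmk : m ≠ k) {U : ι → Finset α}
    (hU : ∀ p, U p ⊆ S p) (hm : U m ⊆ S k) :
    transversalSets (univ.erase k) U ⊆ F := by
  intro f hf
  obtain ⟨c, hc, rfl⟩ := mem_transversalSets.1 hf
  exact hB.image_erase_mem hF hn hmk (fun i hi => hU i (hc i (by simp [hi])))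
    (hm (hc m (by simp [hmk])))

/-- Such transversal sets contain a point of `S m ∩ S k`, which is not private. -/
theorem not_subset_privatePart_of_mem_transversalSets {k m : ι} (hmk : m ≠ k) {U : ι → Finset α}
    (hU : ∀ p, U p ⊆ S p) (hm : U m ⊆ S k) {f : Finset α}
    (hf : f ∈ transversalSets (univ.erase k) U) : ¬ f ⊆ univ.biUnion (privatePart S) := by
  obtain ⟨c, hc, rfl⟩ := mem_transversalSets.1 hf
  have h1 := hc m (by simp [hmk])
  intro h
  exact notMem_biUnion_privatePart hmk (hU m h1) (hm h1)
    (h (mem_image.2 ⟨m, by simp [hmk], rfl⟩))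

/-- A choice of one point in two of the triangle's lists at once, one in its third list and one in
every list outside gives a member of `F`. The families `A`, `B`, `C` split these members by the
first of `S i ∩ S j`, `S i ∩ S l`, `S j ∩ S l` that they meet. -/
theorem Blocks.triangle_bound {n δ : ℕ} (hB : Blocks F S) (hF : ∀ f ∈ F, f.card = n)
    (hn : Fintype.card ι = n + 1) (hn3 : 3 ≤ n) (hδ : ∀ i, (S i).card = δ) {i j l : ι}
    (h : IsTriangle S i j l) : 11 * δ ^ n ≤ 16 * F.card := by
  rcases Nat.eq_zero_or_pos δ with rfl | hδ0
  · rw [zero_pow (by omega)]; omega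
  have hα : Nonempty α := by
    obtain ⟨x, -⟩ := card_pos.1 (by rw [hδ i]; exact hδ0)
    exact ⟨x⟩
  have hnt : Nontrivial ι := ⟨i, j, h.ij⟩
  have hij := h.ij
  have hil := h.il
  have hjl := h.jl
  have hout : ∀ {p}, p ∉ ({i, j, l} : Finset ι) → p ≠ i ∧ p ≠ j ∧ p ≠ l := by
    intro p hp; simpa using hp
  obtain ⟨A, hA⟩ : ∃ A, A = Function.update S i (S i ∩ S j) := ⟨_, rfl⟩
  obtain ⟨B, hBdef⟩ : ∃ B, B =
    Function.update (Function.update S j (S j \ S i)) i (S i ∩ S l) := ⟨_, rfl⟩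
  obtain ⟨C, hC⟩ : ∃ C, C =
    Function.update (Function.update S i (privatePart S i)) j (S j ∩ S l) := ⟨_, rfl⟩
  have hAi : A i = S i ∩ S j := by simp [hA]
  have hA' : ∀ p, p ≠ i → A p = S p := fun p hp => by simp [hA, hp]
  have hBi : B i = S i ∩ S l := by simp [hBdef]
  have hBj : B j = S j \ S i := by simp [hBdef, hij.symm]
  have hB' : ∀ p, p ≠ i → p ≠ j → B p = S p := fun p hp hq => by simp [hBdef, hp, hq]
  have hCi : C i = privatePart S i := by simp [hC, hij]
  have hCj : C j = S j ∩ S l := by simp [hC]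
  have hC' : ∀ p, p ≠ i → p ≠ j → C p = S p := fun p hp hq => by simp [hC, hp, hq]
  have hAS : ∀ p, A p ⊆ S p := by
    intro p
    by_cases hp : p = i
    · subst hp; rw [hAi]; exact inter_subset_left
    · rw [hA' p hp]
  have hBS : ∀ p, B p ⊆ S p := by
    intro p
    by_cases hp : p = i
    · subst hp; rw [hBi]; exact inter_subset_left
    · by_cases hq : p = j
      · subst hq; rw [hBj]; exact sdiff_subset
      · rw [hB' p hp hq]
  have hCS : ∀ p, C p ⊆ S p := by
    intro p
    by_cases hp : p = i
    · subst hp; rw [hCi]; exact sdiff_subset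
    · by_cases hq : p = j
      · subst hq; rw [hCj]; exact inter_subset_left
      · rw [hC' p hp hq]
  have cardA : (transversalSets (univ.erase j) A).card = δ * (S i ∩ S j).card * δ ^ (n - 2) := by
    rw [h.rotate.rotate.card_transversalSets hn hδ hAS, hAi, hA' l hil.symm, hδ]
    · rw [hAi, hA' l hil.symm]
      refine disjoint_left.2 fun x hx hx' => ?_
      simp only [mem_inter] at hx'
      exact h.no_common x hx'.1 hx'.2 hx
    · intro p hp
      apply hA'
      rintro rfl; simp at hp
  have cardB : (transversalSets (univ.erase l) B).card =
      (S i ∩ S l).card * (S j \ S i).card * δ ^ (n - 2) := by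
    rw [h.card_transversalSets hn hδ hBS, hBi, hBj]
    · rw [hBi, hBj]
      exact disjoint_left.2 fun x hx hx' => (mem_sdiff.1 hx').2 (mem_inter.1 hx).1
    · exact fun p hp => hB' p (hout hp).1 (hout hp).2.1
  have cardC : (transversalSets (univ.erase l) C).card =
      (privatePart S i).card * (S j ∩ S l).card * δ ^ (n - 2) := by
    rw [h.card_transversalSets hn hδ hCS, hCi, hCj]
    · rw [hCi, hCj]
      exact disjoint_left.2 fun x hx hx' =>
        (mem_privatePart.1 hx).2 j hij.symm (mem_inter.1 hx').1
    · exact fun p hp => hC' p (hout hp).1 (hout hp).2.1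
  have hAj : A i ⊆ S j := by rw [hAi]; exact inter_subset_right
  have hBl : B i ⊆ S l := by rw [hBi]; exact inter_subset_right
  have hCl : C j ⊆ S l := by rw [hCj]; exact inter_subset_right
  have dAB : Disjoint (transversalSets (univ.erase j) A) (transversalSets (univ.erase l) B) := by
    refine (disjoint_transversalSets (m := i) (by simp [hij]) fun p hp => ?_)
    rw [hAi]
    refine disjoint_left.2 fun x hx hx' => ?_
    obtain ⟨hxi, hxj⟩ := mem_inter.1 hx
    by_cases hpi : p = i
    · subst hpi
      rw [hBi] at hx'
      exact h.no_common x hxi hxj (mem_inter.1 hx').2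
    · by_cases hpj : p = j
      · subst hpj
        rw [hBj] at hx'
        exact (mem_sdiff.1 hx').2 hxi
      · rw [hB' p hpi hpj] at hx'
        exact h.notMem (q := i) (by simp [hpi, hpj, (mem_erase.1 hp).1]) hpi hx' hxi
  have dAC : Disjoint (transversalSets (univ.erase j) A) (transversalSets (univ.erase l) C) := by
    refine (disjoint_transversalSets (m := i) (by simp [hij]) fun p hp => ?_)
    rw [hAi]
    refine disjoint_left.2 fun x hx hx' => ?_
    obtain ⟨hxi, hxj⟩ := mem_inter.1 hx
    by_cases hpi : p = i
    · subst hpi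
      rw [hCi] at hx'
      exact (mem_privatePart.1 hx').2 j hij.symm hxj
    · by_cases hpj : p = j
      · subst hpj
        rw [hCj] at hx'
        exact h.no_common x hxi hxj (mem_inter.1 hx').2
      · rw [hC' p hpi hpj] at hx'
        exact h.notMem (q := i) (by simp [hpi, hpj, (mem_erase.1 hp).1]) hpi hx' hxi
  have dBC : Disjoint (transversalSets (univ.erase l) B) (transversalSets (univ.erase l) C) := by
    refine (disjoint_transversalSets (m := i) (by simp [hil]) fun p hp => ?_)
    rw [hBi]
    refine disjoint_left.2 fun x hx hx' => ?_
    obtain ⟨hxi, hxl⟩ := mem_inter.1 hx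
    by_cases hpi : p = i
    · subst hpi
      rw [hCi] at hx'
      exact (mem_privatePart.1 hx').2 l hil.symm hxl
    · by_cases hpj : p = j
      · subst hpj
        rw [hCj] at hx'
        exact h.no_common x hxi (mem_inter.1 hx').1 hxl
      · rw [hC' p hpi hpj] at hx'
        exact h.notMem (q := i) (by simp [hpi, hpj, (mem_erase.1 hp).1]) hpi hx' hxi
  -- a list outside the triangle has the largest private part
  obtain ⟨m, hm⟩ : ∃ m, m ∈ ({i, j, l} : Finset ι)ᶜ :=
    card_pos.1 (by rw [h.card_compl hn]; omega)
  rw [mem_compl] at hm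
  have hmax : ∀ p, (privatePart S p).card ≤ (privatePart S m).card := by
    intro p
    rw [h.privatePart_eq hm, hδ, ← hδ p]
    exact card_le_card sdiff_subset
  have hmain := hB.add_prod_erase_le_card hF hn hmax
    (G := transversalSets (univ.erase j) A ∪
      (transversalSets (univ.erase l) B ∪ transversalSets (univ.erase l) C))
    (union_subset (hB.transversalSets_subset hF hn hij hAS hAj)
      (union_subset (hB.transversalSets_subset hF hn hil hBS hBl)
        (hB.transversalSets_subset hF hn hjl hCS hCl)))
    (fun f hf => by
      rcases mem_union.1 hf with hf | hf
      · exact not_subset_privatePart_of_mem_transversalSets hij hAS hAj hf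
      · rcases mem_union.1 hf with hf | hf
        · exact not_subset_privatePart_of_mem_transversalSets hil hBS hBl hf
        · exact not_subset_privatePart_of_mem_transversalSets hjl hCS hCl hf)
  have hprod : ∏ p ∈ univ.erase m, (privatePart S p).card = (privatePart S i).card *
      ((privatePart S j).card * ((privatePart S l).card * δ ^ (n - 3))) := by
    obtain ⟨hmi, hmj, hml⟩ := hout hm
    have he : univ.erase m = insert i (insert j (insert l (({i, j, l} : Finset ι)ᶜ.erase m))) := by
      ext p
      simp only [mem_erase, mem_univ, and_true, mem_insert, mem_compl, mem_singleton]
      grind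
    rw [he, prod_insert (by simp [hij, hil]), prod_insert (by simp [hjl]),
      prod_insert (by simp), prod_congr rfl (g := fun _ => δ), prod_const,
      card_erase_of_mem (mem_compl.2 hm), h.card_compl hn]
    · rfl
    · intro p hp
      rw [h.privatePart_eq (mem_compl.1 (mem_erase.1 hp).2), hδ]
  rw [card_union_of_disjoint (disjoint_union_right.2 ⟨dAB, dAC⟩), card_union_of_disjoint dBC,
    cardA, cardB, cardC, hprod] at hmain
  have ci := h.card_privatePart hδ
  have cj := h.rotate.card_privatePart hδ
  have cl := h.rotate.rotate.card_privatePart hδ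
  rw [inter_comm (S j) (S i)] at cj
  rw [inter_comm (S l) (S i), inter_comm (S l) (S j)] at cl
  have cs := card_sdiff_add_card_inter (S j) (S i)
  rw [hδ, inter_comm (S j) (S i)] at cs
  have e2 : δ ^ (n - 2) = δ * δ ^ (n - 3) := by
    rw [← pow_succ']; congr 1; omega
  have e3 : δ ^ n = δ ^ 3 * δ ^ (n - 3) := by
    rw [← pow_add]; congr 1; omega
  rw [e2] at hmain
  rw [e3]
  generalize (S i ∩ S j).card = x at *
  generalize (S i ∩ S l).card = y at *
  generalize (S j ∩ S l).card = z at *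
  generalize (privatePart S i).card = a at *
  generalize (privatePart S j).card = b at *
  generalize (privatePart S l).card = c at *
  generalize (S j \ S i).card = e at *
  generalize δ ^ (n - 3) = D at *
  have ci' : (a : ℝ) + x + y = δ := by exact_mod_cast ci
  have cj' : (b : ℝ) + z + x = δ := by exact_mod_cast cj
  have cl' : (c : ℝ) + y + z = δ := by exact_mod_cast cl
  have cs' : (e : ℝ) + x = δ := by exact_mod_cast cs
  have hT := eleven_cube_le_triangle (d := δ) (x := x) (y := y) (z := z) (Nat.cast_nonneg _)
    (Nat.cast_nonneg _) (Nat.cast_nonneg _) (by linarith [Nat.cast_nonneg (α := ℝ) a])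
    (by linarith [Nat.cast_nonneg (α := ℝ) b]) (by linarith [Nat.cast_nonneg (α := ℝ) c])
  have hmain' : (δ : ℝ) * x * (δ * D) + (y * e * (δ * D) + a * z * (δ * D))
      + a * (b * (c * D)) ≤ F.card := by exact_mod_cast hmain
  have hD : (0 : ℝ) ≤ D := Nat.cast_nonneg _
  have goal : (11 : ℝ) * (δ ^ 3 * D) ≤ 16 * F.card := by
    have ha : (a : ℝ) = δ - x - y := by linarith
    have hb : (b : ℝ) = δ - x - z := by linarith
    have hc : (c : ℝ) = δ - y - z := by linarith
    have he : (e : ℝ) = δ - x := by linarith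
    rw [ha, hb, hc, he] at hmain'
    have := mul_le_mul_of_nonneg_right hT hD
    linarith
  exact_mod_cast goal

/-- A lower bound for a family of `n`-sets that blocks `n + 1` lists of size `δ`. The parameters
`v` and `r` describe the balanced splitting of `(n - 1) * δ` into `n` parts; by `hP` its product is
so large that a triangle is no better than a star. -/
theorem Blocks.pow_le_card_add {n δ v r : ℕ} (hB : Blocks F S) (hF : ∀ f ∈ F, f.card = n)
    (hn : Fintype.card ι = n + 1) (hn3 : 3 ≤ n) (hδ : ∀ i, (S i).card = δ) (hδ0 : 0 < δ)
    (hv : 2 ≤ v) (hr : r ≤ n) (hsum : (n - 1) * δ + r = n * v)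
    (hP : 5 * δ ^ n ≤ 16 * (v ^ (n - r) * (v - 1) ^ r)) :
    δ ^ n ≤ F.card + v ^ (n - r) * (v - 1) ^ r := by
  have hne : ∀ i, (S i).Nonempty := fun i => card_pos.1 (by rw [hδ i]; exact hδ0)
  have hnt : Nontrivial ι := Fintype.one_lt_card_iff_nontrivial.1 (by omega)
  rcases hB.star_or_triangle hF hn hne with ⟨k, hk⟩ | ⟨i, j, l, hij, hil, hjl, htri⟩
  · exact hB.star_bound hF hn hδ hk hv hr hsum
  · have := hB.triangle_bound hF hn hn3 hδ ⟨hij, hil, hjl, htri,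
      fun x hi hj => hB.not_mem_three hF hn hne hij hil hjl hi hj⟩
    omega

end Bounds

/-! ### The extremal lists -/

section Construction

variable {ι α : Type*} [DecidableEq α] [Fintype ι] [DecidableEq ι]

/-- The star whose centre `k` takes `x i` points from the `i`-th of the other lists, these being
pairwise disjoint. -/
theorem exists_blocks [Infinite α] {n δ : ℕ} (hn : Fintype.card ι = n + 1) (k : ι) (x : ι → ℕ)
    (hx : ∀ i, x i ≤ δ) (hsum : ∑ i ∈ univ.erase k, x i = δ) :
    ∃ (S : ι → Finset α) (F : Finset (Finset α)), (∀ i, (S i).card = δ) ∧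
      (∀ f ∈ F, f.card = n) ∧ Blocks F S ∧ F.card + ∏ i ∈ univ.erase k, (δ - x i) = δ ^ n := by
  obtain ⟨g⟩ : Nonempty (ι × Fin δ ↪ α) := by
    obtain ⟨t, ht⟩ := Infinite.exists_subset_card_eq α (Fintype.card (ι × Fin δ))
    exact ⟨(Fintype.equivFinOfCardEq rfl).toEmbedding.trans
      ((t.equivFinOfCardEq ht).symm.toEmbedding.trans (Function.Embedding.subtype _))⟩
  have hcard : (univ.erase k).card = n := by
    rw [card_erase_of_mem (mem_univ _), card_univ, hn, Nat.add_sub_cancel]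
  obtain ⟨T, hT⟩ : ∃ T : ι → Finset (Fin δ) → Finset α,
      T = fun i s => s.image fun y => g (i, y) := ⟨_, rfl⟩
  have memT : ∀ {i s z}, z ∈ T i s ↔ ∃ y ∈ s, g (i, y) = z := by
    intro i s z; simp [hT]
  have cardT : ∀ i s, (T i s).card = s.card := by
    intro i s
    rw [hT]
    exact card_image_of_injective _ fun a b hab => by simpa using hab
  have disjT : ∀ {i j} s t, i ≠ j → Disjoint (T i s) (T j t) := by
    intro i j s t hij
    refine disjoint_left.2 fun z hz hz' => ?_
    obtain ⟨y, -, rfl⟩ := memT.1 hz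
    obtain ⟨y', -, h⟩ := memT.1 hz'
    have := g.injective h
    simp only [Prod.mk.injEq] at this
    exact hij this.1.symm
  have hX : ∀ i, ∃ X : Finset (Fin δ), X.card = x i := by
    intro i
    obtain ⟨X, -, hX⟩ := exists_subset_card_eq (s := (univ : Finset (Fin δ))) (n := x i)
      (by simpa using hx i)
    exact ⟨X, hX⟩
  choose X hX using hX
  obtain ⟨Sk, hSk⟩ : ∃ Sk, Sk = (univ.erase k).biUnion fun i => T i (X i) := ⟨_, rfl⟩
  obtain ⟨S, hS⟩ : ∃ S, S = Function.update (fun i => T i univ) k Sk := ⟨_, rfl⟩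
  have hS' : ∀ i, i ≠ k → S i = T i univ := fun i hi => by simp [hS, hi]
  have hSk' : S k = Sk := by simp [hS]
  have hpd : ∀ Y : ι → Finset (Fin δ),
      ((univ.erase k : Finset ι) : Set ι).PairwiseDisjoint fun i => T i (Y i) :=
    fun Y i _ j _ hij => disjT _ _ hij
  have hα : Nonempty α := inferInstance
  obtain ⟨F, hF⟩ : ∃ F, F = transversalSets (univ.erase k) (fun i => T i univ) \
    transversalSets (univ.erase k) (fun i => T i (X i)ᶜ) := ⟨_, rfl⟩
  refine ⟨S, F, fun i => ?_, fun f hf => ?_, fun c hc => ?_, ?_⟩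
  · by_cases hi : i = k
    · subst hi
      rw [hSk', hSk, card_biUnion fun i hi j hj hij => disjT _ _ hij, ← hsum]
      exact sum_congr rfl fun i _ => by rw [cardT, hX]
    · rw [hS' i hi, cardT, card_univ, Fintype.card_fin]
  · rw [hF, mem_sdiff] at hf
    obtain ⟨c, hc, rfl⟩ := mem_transversalSets.1 hf.1
    rw [card_image_of_injOn (injOn_of_mem_disjoint (hpd fun _ => univ) hc), hcard]
  · have h1 : c k ∈ Sk := hSk' ▸ hc k
    rw [hSk] at h1
    obtain ⟨m, hm, hcm⟩ := mem_biUnion.1 h1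
    have hmk : m ≠ k := by simpa using hm
    -- use the colour chosen at the centre in place of the one chosen at `m`
    obtain ⟨d, hd⟩ : ∃ d, d = Function.update c m (c k) := ⟨_, rfl⟩
    have hdm : d m = c k := by simp [hd]
    have hd' : ∀ i, i ≠ m → d i = c i := fun i hi => by simp [hd, hi]
    refine ⟨(univ.erase k).image d, ?_, ?_⟩
    · rw [hF, mem_sdiff]
      constructor
      · refine mem_transversalSets.2 ⟨d, fun i hi => ?_, rfl⟩
        by_cases him : i = m
        · subst him
          rw [hdm]
          obtain ⟨y, -, h⟩ := memT.1 hcm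
          exact memT.2 ⟨y, mem_univ _, h⟩
        · rw [hd' i him, ← hS' i (by simpa using hi)]
          exact hc i
      · intro h
        obtain ⟨e, he, hed⟩ := mem_transversalSets.1 h
        have h2 : c k ∈ (univ.erase k).image e := by
          rw [hed, ← hdm]; exact mem_image.2 ⟨m, hm, rfl⟩
        obtain ⟨p, hp, hpe⟩ := mem_image.1 h2
        have h3 := he p hp
        rw [hpe] at h3
        obtain ⟨y, hy, hgy⟩ := memT.1 hcm
        obtain ⟨y', hy', hgy'⟩ := memT.1 h3
        have h4 := g.injective (hgy.trans hgy'.symm)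
        simp only [Prod.mk.injEq] at h4
        obtain ⟨rfl, rfl⟩ := h4
        exact mem_compl.1 hy' hy
    · intro z hz
      obtain ⟨i, -, rfl⟩ := mem_image.1 hz
      by_cases him : i = m
      · subst him
        rw [hdm]; exact mem_image.2 ⟨k, mem_univ _, rfl⟩
      · rw [hd' i him]; exact mem_image.2 ⟨i, mem_univ _, rfl⟩
  · have hsub : transversalSets (univ.erase k) (fun i => T i (X i)ᶜ) ⊆
        transversalSets (univ.erase k) (fun i => T i univ) := by
      intro f hf
      obtain ⟨c, hc, rfl⟩ := mem_transversalSets.1 hf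
      refine mem_transversalSets.2 ⟨c, fun i hi => ?_, rfl⟩
      obtain ⟨y, -, h⟩ := memT.1 (hc i hi)
      exact memT.2 ⟨y, mem_univ _, h⟩
    have := card_sdiff_add_card_eq_card hsub
    rw [← hF, card_transversalSets (hpd fun _ => univ), card_transversalSets (hpd fun i => (X i)ᶜ)]
      at this
    simp only [cardT, card_univ, Fintype.card_fin, prod_const, hcard, card_compl, hX] at this
    exact this

/-- With the sizes as equal as possible, `r` of them `q + 1` and the others `q`. -/
theorem exists_blocks_balanced [Infinite α] {n δ q r : ℕ} (hn : Fintype.card ι = n + 1)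
    (hδ : δ = q * n + r) (hr : r ≤ n) (hq : q + 1 ≤ δ) :
    ∃ (S : ι → Finset α) (F : Finset (Finset α)), (∀ i, (S i).card = δ) ∧
      (∀ f ∈ F, f.card = n) ∧ Blocks F S ∧
        F.card + (δ - q) ^ (n - r) * (δ - q - 1) ^ r = δ ^ n := by
  obtain ⟨k⟩ : Nonempty ι := Fintype.card_pos_iff.1 (by omega)
  have hcard : (univ.erase k).card = n := by
    rw [card_erase_of_mem (mem_univ _), card_univ, hn, Nat.add_sub_cancel]
  obtain ⟨R, hR, hRc⟩ := exists_subset_card_eq (s := univ.erase k) (n := r) (by omega)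
  have hsd : (univ.erase k \ R).card = n - r := by rw [card_sdiff_of_subset hR, hcard, hRc]
  have key := exists_blocks (α := α) (δ := δ) hn k (fun i => if i ∈ R then q + 1 else q)
    (fun i => by split_ifs <;> omega) (by
      rw [← sum_sdiff hR, sum_congr rfl (g := fun _ => q), sum_congr (s₁ := R) rfl
        (g := fun _ => q + 1), sum_const, sum_const, hsd, hRc, smul_eq_mul, smul_eq_mul, hδ]
      · obtain ⟨s, rfl⟩ := Nat.exists_eq_add_of_le hr
        rw [Nat.add_sub_cancel_left]; ring
      · intro i hi; simp [hi]
      · intro i hi; simp [(mem_sdiff.1 hi).2])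
  have hp : ∏ i ∈ univ.erase k, (δ - if i ∈ R then q + 1 else q) =
      (δ - q) ^ (n - r) * (δ - q - 1) ^ r := by
    rw [← prod_sdiff hR, prod_congr rfl (g := fun _ => δ - q), prod_congr (s₁ := R) rfl
        (g := fun _ => δ - q - 1), prod_const, prod_const, hsd, hRc]
    · intro i hi; simp [hi, Nat.sub_sub]
    · intro i hi; simp [(mem_sdiff.1 hi).2]
  rwa [hp] at key

/-! ### Choosability -/

/-- A colouring of `B` extends to `A` exactly when it uses up no list of `A`. -/
theorem isBipartiteChoosable_iff_not_blocks {a b kA kB : ℕ} :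
    IsBipartiteChoosable (completeBipartiteGraph (Fin a) (Fin b)) kA kB ↔
      ∀ (F : Finset (Finset ℕ+)) (S : Fin b → Finset ℕ+), F.card ≤ a → (∀ f ∈ F, f.card = kA) →
        (∀ v, (S v).card = kB) → ¬ Blocks F S := by
  constructor
  · intro h F S hFa hF hS hB
    obtain ⟨D, hD⟩ := Infinite.exists_subset_card_eq ℕ+ kA
    obtain ⟨e⟩ : Nonempty (F ↪ Fin a) :=
      Function.Embedding.nonempty_of_card_le (by simpa using hFa)
    -- the vertices of `A` left over get the irrelevant list `D`
    obtain ⟨c, hcA, hcB⟩ := h (Function.extend e Subtype.val fun _ => D) S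
      (fun u => by
        by_cases hu : ∃ f, e f = u
        · obtain ⟨f, rfl⟩ := hu
          rw [e.injective.extend_apply]; exact hF _ f.2
        · rw [Function.extend_apply' _ _ _ hu]; exact hD) hS
    obtain ⟨f, hf, hfc⟩ := hB (fun v => c (Sum.inr v)) hcB
    have h1 := hcA (e ⟨f, hf⟩)
    rw [e.injective.extend_apply] at h1
    obtain ⟨v, -, hv⟩ := mem_image.1 (hfc h1)
    exact c.valid (v := Sum.inr v) (w := Sum.inl (e ⟨f, hf⟩)) (by simp) hv
  · intro h LA LB hLA hLB
    have h1 := h (univ.image LA) LB (card_image_le.trans (by simp))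
      (fun f hf => by obtain ⟨u, -, rfl⟩ := mem_image.1 hf; exact hLA u) hLB
    simp only [Blocks, not_forall] at h1
    obtain ⟨c, hc, h2⟩ := h1
    have h3 : ∀ u, ∃ y ∈ LA u, y ∉ univ.image c := by
      intro u
      by_contra! h4
      exact h2 ⟨LA u, mem_image.2 ⟨u, mem_univ _, rfl⟩, h4⟩
    choose y hy hyc using h3
    refine ⟨SimpleGraph.Coloring.mk (Sum.elim y c) ?_, hy, hc⟩
    rintro (u | u) (v | v) huv
    · simp at huv
    · intro h5
      exact hyc u (mem_image.2 ⟨v, mem_univ _, h5.symm⟩)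
    · intro h5
      exact hyc v (mem_image.2 ⟨u, mem_univ _, h5⟩)
    · simp at huv

end Construction

/-- `(1 - t / n) ^ n` at `t = 1.001` and `n = 4` is `0.3159…`, a little above `5 / 16`. -/
theorem five_sixteenths_le_balanced_prod {n δ q r : ℕ} (hn : 4 ≤ n) (hδ : δ = q * n + r)
    (hr : r ≤ n) (hCδ : 1000 * n ≤ δ) (hq : q + 1 ≤ δ) :
    5 * δ ^ n ≤ 16 * ((δ - q) ^ (n - r) * (δ - q - 1) ^ r) := by
  have hn' : (4 : ℝ) ≤ n := by exact_mod_cast hn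
  have h1 := balanced_prod_ge (C := 1000) (by omega) (by norm_num) hδ hCδ
    (by push_cast; linarith) hr
  have h2 := one_sub_div_pow_mono (t := 1 + 1 / ((1000 : ℕ) : ℝ)) (m := 4) (n := n) (by norm_num)
    hn (by norm_num)
  have h3 : (5 : ℝ) / 16 ≤ (1 - (1 + 1 / ((1000 : ℕ) : ℝ)) / (4 : ℕ)) ^ 4 := by norm_num
  have h4 : (0 : ℝ) ≤ (δ : ℝ) ^ n := by positivity
  have h5 : (5 : ℝ) / 16 * (δ : ℝ) ^ n ≤ ((δ : ℝ) - q) ^ (n - r) * ((δ : ℝ) - q - 1) ^ r :=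
    (mul_le_mul_of_nonneg_right (h3.trans h2) h4).trans h1
  have h6 : (5 : ℝ) * δ ^ n ≤ 16 * (((δ : ℝ) - q) ^ (n - r) * ((δ : ℝ) - q - 1) ^ r) := by linarith
  have e1 : ((δ - q - 1 : ℕ) : ℝ) = (δ : ℝ) - q - 1 := by
    rw [Nat.sub_sub, Nat.cast_sub hq]; push_cast; ring
  have e2 : ((δ - q : ℕ) : ℝ) = (δ : ℝ) - q := by rw [Nat.cast_sub (by omega)]
  rw [← e1, ← e2] at h6
  exact_mod_cast h6

theorem proposition7p1 :
    -- the characterisation, with `δ ≫ b` read as `δ ≥ C * b` for an absolute constant `C`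
    (∃ C : ℕ, ∀ b δ q r : ℕ, 5 ≤ b → δ = q * (b - 1) + r → r ≤ b - 2 → C * b ≤ δ →
      ∀ a : ℕ,
        IsBipartiteChoosable (completeBipartiteGraph (Fin a) (Fin b)) (b - 1) δ ↔
          (a : ℤ) < (δ : ℤ) ^ (b - 1)
            - (((b : ℤ) - 2) * q + r) ^ (b - 1 - r) * (((b : ℤ) - 2) * q + r - 1) ^ r) ∧
    -- the size of the bound for `1 ≪ b ≪ δ`
    (∀ ε : ℝ, 0 < ε → ∃ b₀ C : ℕ, ∀ b δ q r : ℕ, b₀ ≤ b → 5 ≤ b →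
      δ = q * (b - 1) + r → r ≤ b - 2 → C * b ≤ δ →
        |((δ : ℝ) ^ (b - 1)
            - (((b : ℝ) - 2) * q + r) ^ (b - 1 - r) * (((b : ℝ) - 2) * q + r - 1) ^ r)
          - (1 - 1 / Real.exp 1) * (δ : ℝ) ^ (b - 1)| ≤ ε * (δ : ℝ) ^ (b - 1)) := by
  constructor
  · refine ⟨1000, fun b δ q r hb hδ hr hCδ a => ?_⟩
    obtain ⟨n, rfl⟩ : ∃ n, b = n + 1 := ⟨b - 1, by omega⟩
    rw [Nat.add_sub_cancel] at hδ ⊢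
    have hqn : 4 * q ≤ q * n := by rw [mul_comm]; exact Nat.mul_le_mul_left q (by omega)
    have hq : q + 1 ≤ δ := by omega
    have hv : 2 ≤ δ - q := by omega
    have e1 : (((n + 1 : ℕ) : ℤ) - 2) * q + r = ((δ - q : ℕ) : ℤ) := by
      rw [Nat.cast_sub (by omega), hδ]; push_cast; ring
    have e2 : ((δ - q : ℕ) : ℤ) - 1 = ((δ - q - 1 : ℕ) : ℤ) := by omega
    rw [e1, e2, isBipartiteChoosable_iff_not_blocks]
    have hP := five_sixteenths_le_balanced_prod (by omega) hδ (by omega) (by omega) hq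
    generalize hPdef : (δ - q) ^ (n - r) * (δ - q - 1) ^ r = P at hP
    have e3 : ((δ - q : ℕ) : ℤ) ^ (n - r) * ((δ - q - 1 : ℕ) : ℤ) ^ r = (P : ℤ) := by
      rw [← hPdef]; push_cast; rfl
    rw [e3]
    constructor
    · intro h
      by_contra hcon
      obtain ⟨S, F, hS, hF, hB, hc⟩ := exists_blocks_balanced (ι := Fin (n + 1)) (α := ℕ+)
        (by simp) hδ (by omega) hq
      refine h F S ?_ hF hS hB
      rw [hPdef] at hc
      have hc' : (F.card : ℤ) + P = (δ : ℤ) ^ n := by exact_mod_cast hc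
      omega
    · intro ha F S hFa hF hS hB
      have hsum : (n - 1) * δ + r = n * (δ - q) := by
        obtain ⟨m, rfl⟩ : ∃ m, n = m + 1 := ⟨n - 1, by omega⟩
        obtain ⟨w, hw⟩ := Nat.exists_eq_add_of_le (show q ≤ δ by omega)
        rw [hw, Nat.add_sub_cancel_left, Nat.add_sub_cancel]
        rw [hw] at hδ
        nlinarith
      have := hB.pow_le_card_add hF (by simp) (by omega) hS (by omega) hv (by omega) hsum
        (by rw [hPdef]; exact hP)
      rw [hPdef] at this
      have h' : (δ : ℤ) ^ n ≤ F.card + P := by exact_mod_cast this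
      omega
  · intro ε hε
    obtain ⟨m, hm4, hm⟩ := exists_one_sub_div_pow_ge hε
    -- the relative loss `1 / m` from rounding vanishes together with `1 / n`, so one `m` serves both
    refine ⟨m + 1, m, fun b δ q r hmb hb hδ hr hCδ => ?_⟩
    obtain ⟨n, rfl⟩ : ∃ n, b = n + 1 := ⟨b - 1, by omega⟩
    rw [Nat.add_sub_cancel] at hδ ⊢
    have hqn : 4 * q ≤ q * n := by rw [mul_comm]; exact Nat.mul_le_mul_left q (by omega)
    have hδ5 : 20 ≤ δ := le_trans (Nat.mul_le_mul hm4 hb) hCδ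
    have hq : q + 1 ≤ δ := by omega
    have hm' : (4 : ℝ) ≤ m := by exact_mod_cast hm4
    have hmn : (m : ℝ) ≤ n := by exact_mod_cast (by omega : m ≤ n)
    have h1m : 1 / (m : ℝ) ≤ 1 := by rw [div_le_one (by linarith)]; linarith
    have e1 : (((n + 1 : ℕ) : ℝ) - 2) * q + r = (δ : ℝ) - q := by
      rw [hδ]; push_cast; ring
    rw [e1]
    have hub := balanced_prod_le (by omega) hδ (by omega) hq
    have hlb := balanced_prod_ge (n := n) (C := m) (by omega) (by omega) hδ
      (by rw [mul_add] at hCδ; omega) (by linarith) (by omega)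
    have hmono := one_sub_div_pow_mono (t := 1 + 1 / (m : ℝ)) (m := m) (n := n) (by omega)
      (by omega) (by linarith)
    have h0 : (0 : ℝ) ≤ (δ : ℝ) ^ n := by positivity
    have hlb' := (mul_le_mul_of_nonneg_right (hm.trans hmono) h0).trans hlb
    rw [Real.exp_neg, ← one_div] at hub hlb'
    have hε0 := mul_nonneg hε.le h0
    rw [abs_le]
    constructor <;> linarith
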